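/- Conventions. A gyrogroup is a nonempty set $G$ with a binary operation $\oplus$ that has a two-sided identity $0$, two-sided inverses $\ominus x$, and automorphisms $\operatorname{gyr}[x,y]$ of $(G,\oplus)$ $(x,y\in G)$ such that $x\oplus(y\oplus z)=(x\oplus y)\oplus\operatorname{gyr}[x,y](z)$ and $\operatorname{gyr}[x\oplus y,y]=\operatorname{gyr}[x,y]$ for all $x,y,z\in G$. A subgyrogroup of $G$ is a nonempty subset that is closed under $\oplus$ and is a gyrogroup under the restricted operation; $\langle L\rangle$ denotes the smallest subgyrogroup containing $L$ (so $\langle\emptyset\rangle=\{0\}$). A topological gyrogroup is a gyrogroup with a topology for which $\oplus$ is jointly continuous and $\ominus$ is continuous; it is strongly topological if $0$ has a neighborhood base $\mathscr U$ with $\operatorname{gyr}[x,y](U)=U$ for all $U\in\mathscr U$ and $x,y\in G$. It is left precompact if for every nonempty open $U\subset G$ there is a finite $F\subset G$ with $F\oplus U=G$. A space has countable pseudocharacter if each of its points is the intersection of countably many open sets. A subset $S$ of a topological gyrogroup $G$ is a suitable set for $G$ if $S$ is discrete in the subspace topology, $\langle S\rangle$ is dense in $G$, and $S\cup\{0\}$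 is closed in $G$. Statement. Let $G$ be a separable, left precompact, Hausdorff strongly topological gyrogroup of countable pseudocharacter, and let $P$ be a countable dense subgyrogroup of $G$. Then there is a set $L\subset P\setminus\{0\}$ that is discrete in the subspace topology and closed in the subspace $G\setminus\{0\}$ such that $P=\langle L\rangle$. Moreover, this $L$ is a suitable set both for $P$ (with the subspace topology and the restricted operation) and for $G$. -/

import Mathlib

open Topology

/-- A gyrogroup, written additively (`⊕` is `+` and `⊖` is `-`).  The identity, the inverses and the
gyrations `gyr x y ∈ Aut (G, +)` are data; all three are determined by `+`. -/
class Gyrogroup (G : Type*) extends Add G, Zero G, Neg G where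
  protected zero_add : ∀ a : G, 0 + a = a
  protected add_zero : ∀ a : G, a + 0 = a
  protected neg_add_cancel : ∀ a : G, -a + a = 0
  protected add_neg_cancel : ∀ a : G, a + -a = 0
  gyr : G → G → (G ≃+ G)
  gyr_assoc : ∀ x y z : G, x + (y + z) = (x + y) + gyr x y z
  gyr_loop : ∀ x y : G, gyr (x + y) y = gyr x y

namespace Gyrogroup

variable {G : Type*} [Gyrogroup G]

theorem gyr_zero_left (b z : G) : gyr 0 b z = z := by
  have h1 := gyr_assoc 0 b z
  rw [Gyrogroup.zero_add, Gyrogroup.zero_add] at h1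
  have h2 := gyr_assoc (-b) b z
  rw [h1, gyr_assoc, Gyrogroup.neg_add_cancel, Gyrogroup.zero_add, Gyrogroup.zero_add] at h2
  exact (gyr (-b) b).injective h2

theorem neg_add_cancel_left (a b : G) : -a + (a + b) = b := by
  rw [gyr_assoc, ← gyr_loop, Gyrogroup.neg_add_cancel, Gyrogroup.zero_add, gyr_zero_left]

theorem add_left_cancel' {a b c : G} (h : a + b = a + c) : b = c := by
  rw [← neg_add_cancel_left a b, h, neg_add_cancel_left]

theorem gyr_eq (x y z : G) : gyr x y z = -(x + y) + (x + (y + z)) := by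
  rw [gyr_assoc x y z, neg_add_cancel_left]

end Gyrogroup

open Gyrogroup in
/-- A subgyrogroup of `G`: a nonempty subset `H` that is closed under `+`, on which every `gyr x y`
(`x, y ∈ H`) restricts to a bijective homomorphism onto its image (additivity being automatic), and
that is a gyrogroup under the restriction of `+`. -/
structure Subgyrogroup (G : Type*) [Gyrogroup G] where
  carrier : Set G
  nonempty' : carrier.Nonempty
  add_mem' : ∀ {x y : G}, x ∈ carrier → y ∈ carrier → x + y ∈ carrier
  gyr_bijOn' : ∀ {x y : G}, x ∈ carrier → y ∈ carrier →
    Set.BijOn (gyr x y) carrier (gyr x y '' carrier)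
  gyrogroup' : ∃ g : Gyrogroup carrier, ∀ x y : carrier, (g.add x y : G) = (x : G) + (y : G)

namespace Subgyrogroup

open Gyrogroup

variable {G : Type*} [Gyrogroup G]

instance : SetLike (Subgyrogroup G) G where
  coe H := H.carrier
  coe_injective H K h := by cases H; cases K; congr

theorem add_mem (H : Subgyrogroup G) {x y : G} (hx : x ∈ H) (hy : y ∈ H) : x + y ∈ H :=
  H.add_mem' hx hy

theorem zero_mem (H : Subgyrogroup G) : (0 : G) ∈ H := by
  obtain ⟨g, hg⟩ := H.gyrogroup'
  have h1 : ((g.zero : H.carrier) : G) + (g.zero : H.carrier) = (g.zero : H.carrier) := by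
    rw [← hg]; exact congrArg Subtype.val (g.zero_add g.zero)
  have h2 : ((g.zero : H.carrier) : G) = 0 :=
    add_left_cancel' (h1.trans (Gyrogroup.add_zero _).symm)
  have h3 := (g.zero : H.carrier).2
  rw [h2] at h3
  exact h3

theorem neg_mem (H : Subgyrogroup G) {x : G} (hx : x ∈ H) : -x ∈ H := by
  obtain ⟨g, hg⟩ := H.gyrogroup'
  have h1 : ((g.zero : H.carrier) : G) + (g.zero : H.carrier) = (g.zero : H.carrier) := by
    rw [← hg]; exact congrArg Subtype.val (g.zero_add g.zero)
  have h2 : ((g.zero : H.carrier) : G) = 0 :=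
    add_left_cancel' (h1.trans (Gyrogroup.add_zero _).symm)
  have h3 : x + (g.neg ⟨x, hx⟩ : H.carrier) = 0 := by
    rw [← h2, ← hg ⟨x, hx⟩]; exact congrArg Subtype.val (g.add_neg_cancel ⟨x, hx⟩)
  have h4 : ((g.neg ⟨x, hx⟩ : H.carrier) : G) = -x :=
    add_left_cancel' (h3.trans (Gyrogroup.add_neg_cancel x).symm)
  have h5 := (g.neg ⟨x, hx⟩ : H.carrier).2
  rw [h4] at h5
  exact h5

theorem gyr_mem (H : Subgyrogroup G) {x y z : G} (hx : x ∈ H) (hy : y ∈ H) (hz : z ∈ H) :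
    gyr x y z ∈ H := by
  rw [gyr_eq]
  exact H.add_mem (H.neg_mem (H.add_mem hx hy)) (H.add_mem hx (H.add_mem hy hz))

theorem gyr_symm_mem (H : Subgyrogroup G) {x y z : G} (hx : x ∈ H) (hy : y ∈ H) (hz : z ∈ H) :
    (gyr x y).symm z ∈ H := by
  obtain ⟨g, hg⟩ := H.gyrogroup'
  obtain ⟨w, hw⟩ := (g.gyr ⟨x, hx⟩ ⟨y, hy⟩).surjective ⟨z, hz⟩
  have h1 := congrArg Subtype.val (g.gyr_assoc ⟨x, hx⟩ ⟨y, hy⟩ w)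
  rw [hw] at h1
  have h2 : x + (y + (w : G)) = (x + y) + z := by
    have e1 := hg ⟨x, hx⟩ (g.add ⟨y, hy⟩ w)
    have e2 := hg (g.add ⟨x, hx⟩ ⟨y, hy⟩) ⟨z, hz⟩
    rw [hg ⟨y, hy⟩ w] at e1
    rw [hg ⟨x, hx⟩ ⟨y, hy⟩] at e2
    exact e1.symm.trans (h1.trans e2)
  rw [gyr_assoc] at h2
  rw [← add_left_cancel' h2, AddEquiv.symm_apply_apply]
  exact w.2

/-- The gyrogroup structure on a subset, from closure under the operations. -/
abbrev gyrogroupOfClosed (S : Set G) (h0 : (0 : G) ∈ S)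
    (hadd : ∀ {x y : G}, x ∈ S → y ∈ S → x + y ∈ S) (hneg : ∀ {x : G}, x ∈ S → -x ∈ S)
    (hsymm : ∀ {x y z : G}, x ∈ S → y ∈ S → z ∈ S → (gyr x y).symm z ∈ S) : Gyrogroup S :=
  letI : Add S := ⟨fun x y => ⟨(x : G) + y, hadd x.2 y.2⟩⟩
  { zero := ⟨0, h0⟩
    neg := fun x => ⟨-(x : G), hneg x.2⟩
    zero_add := fun a => Subtype.ext (Gyrogroup.zero_add (a : G))
    add_zero := fun a => Subtype.ext (Gyrogroup.add_zero (a : G))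
    neg_add_cancel := fun a => Subtype.ext (Gyrogroup.neg_add_cancel (a : G))
    add_neg_cancel := fun a => Subtype.ext (Gyrogroup.add_neg_cancel (a : G))
    gyr := fun x y =>
      { toFun := fun z => ⟨gyr (x : G) y z, by
          rw [gyr_eq]; exact hadd (hneg (hadd x.2 y.2)) (hadd x.2 (hadd y.2 z.2))⟩
        invFun := fun z => ⟨(gyr (x : G) y).symm z, hsymm x.2 y.2 z.2⟩
        left_inv := fun z => Subtype.ext ((gyr (x : G) y).symm_apply_apply z)
        right_inv := fun z => Subtype.ext ((gyr (x : G) y).apply_symm_apply z)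
        map_add' := fun z w => Subtype.ext ((gyr (x : G) y).map_add z w) }
    gyr_assoc := fun x y z => Subtype.ext (gyr_assoc (x : G) y z)
    gyr_loop := fun x y => AddEquiv.ext fun z =>
      Subtype.ext (DFunLike.congr_fun (gyr_loop (x : G) (y : G)) (z : G)) }

/-- A subset that is closed under the operations and the inverse gyrations is a subgyrogroup. -/
def ofClosed (S : Set G) (h0 : (0 : G) ∈ S)
    (hadd : ∀ {x y : G}, x ∈ S → y ∈ S → x + y ∈ S) (hneg : ∀ {x : G}, x ∈ S → -x ∈ S)
    (hsymm : ∀ {x y z : G}, x ∈ S → y ∈ S → z ∈ S → (gyr x y).symm z ∈ S) : Subgyrogroup G where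
  carrier := S
  nonempty' := ⟨0, h0⟩
  add_mem' := hadd
  gyr_bijOn' _ _ := (gyr _ _).injective.injOn.bijOn_image
  gyrogroup' := ⟨gyrogroupOfClosed S h0 hadd hneg hsymm, fun _ _ => rfl⟩

/-- A subgyrogroup is a gyrogroup under the restricted operation. -/
instance (H : Subgyrogroup G) : Gyrogroup H :=
  gyrogroupOfClosed (H : Set G) H.zero_mem H.add_mem H.neg_mem H.gyr_symm_mem

/-- `⟨L⟩`: the smallest subgyrogroup containing `L`, the intersection of all of them. -/
def generate (L : Set G) : Subgyrogroup G :=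
  ofClosed {x | ∀ H : Subgyrogroup G, L ⊆ H → x ∈ H} (fun H _ => H.zero_mem)
    (fun hx hy H hH => H.add_mem (hx H hH) (hy H hH)) (fun hx H hH => H.neg_mem (hx H hH))
    (fun hx hy hz H hH => H.gyr_symm_mem (hx H hH) (hy H hH) (hz H hH))

end Subgyrogroup

/-- A topological gyrogroup: `+` is jointly continuous and `-` is continuous. -/
class IsTopologicalGyrogroup (G : Type*) [TopologicalSpace G] [Gyrogroup G] : Prop
    extends ContinuousAdd G, ContinuousNeg G

/-- A strongly topological gyrogroup: `0` has a neighborhood base `𝒰` of sets that are invariant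
under all gyrations. -/
class IsStronglyTopologicalGyrogroup (G : Type*) [TopologicalSpace G] [Gyrogroup G] : Prop
    extends IsTopologicalGyrogroup G where
  exists_invariant_basis : ∃ 𝒰 : Set (Set G), (𝓝 (0 : G)).HasBasis (fun U => U ∈ 𝒰) id ∧
    ∀ x y : G, ∀ U ∈ 𝒰, Gyrogroup.gyr x y '' U = U

instance Subgyrogroup.isTopologicalGyrogroup {G : Type*} [TopologicalSpace G] [Gyrogroup G]
    [IsTopologicalGyrogroup G] (H : Subgyrogroup G) : IsTopologicalGyrogroup H where
  continuous_add := Continuous.subtype_mk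
    ((continuous_subtype_val.comp continuous_fst).add
      (continuous_subtype_val.comp continuous_snd)) _
  continuous_neg := Continuous.subtype_mk continuous_subtype_val.neg _

/-- Left precompact: every nonempty open `U` has a finite `F` with `F ⊕ U = G`. -/
def LeftPrecompact (G : Type*) [TopologicalSpace G] [Gyrogroup G] : Prop :=
  ∀ U : Set G, IsOpen U → U.Nonempty →
    ∃ F : Set G, F.Finite ∧ Set.image2 (fun f u => f + u) F U = Set.univ

/-- Every point is the intersection of countably many open sets. -/
def HasCountablePseudocharacter (X : Type*) [TopologicalSpace X] : Prop :=
  ∀ x : X, IsGδ ({x} : Set X)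

/-- `S` is a suitable set for `G`: it is discrete in itself, generates a dense subgyrogroup, and
`S ∪ {0}` is closed. -/
structure IsSuitableSet {G : Type*} [TopologicalSpace G] [Gyrogroup G] [IsTopologicalGyrogroup G]
    (S : Set G) : Prop where
  discrete : DiscreteTopology S
  dense_generate : Dense (Subgyrogroup.generate S : Set G)
  isClosed_union : IsClosed (S ∪ {0})

open Filter

namespace Gyrogroup

variable {G : Type*} [Gyrogroup G]

/-! Countable pseudocharacter gives a decreasing sequence `V n` of neighborhoods of `0` whose
closures meet only in `0`. It suffices that `L` generates `P` and has only finitely many elements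
outside each `V n`: a point `x ≠ 0` then has a neighborhood missing some `V n`, hence meeting `L` in
a finite set, so `L` accumulates at most at `0`. Such an `L` is a union of finite sets `A n ⊆ P`,
with `0` removed. The span of `A n` is kept `V n`-dense, so any `f` splits as `h + (-h + f)` with
`h` in the span and `-h + f ∈ V n`; adjoining this small correction puts `f` in the span
(`LeftPrecompact.exists_enlargement`). Each stage captures in this way one more element of `P` and a
finite `V (n + 1)`-net, which left precompactness provides inside `P`. -/

theorem neg_neg' (a : G) : -(-a) = a :=
  add_left_cancel' ((Gyrogroup.add_neg_cancel (-a)).trans (Gyrogroup.neg_add_cancel a).symm)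

theorem add_neg_add_cancel (a b : G) : a + (-a + b) = b := by
  simpa only [neg_neg'] using neg_add_cancel_left (-a) b

end Gyrogroup

/-! ### Generation inside a subgyrogroup -/

namespace Subgyrogroup

variable {G : Type*} [Gyrogroup G]

theorem subset_generate (L : Set G) : L ⊆ generate L := fun _ hx _ hH => hH hx

theorem generate_le {L : Set G} {H : Subgyrogroup G} (h : L ⊆ H) {x : G}
    (hx : x ∈ generate L) : x ∈ H := hx H h

/-- The image in `G` of a subgyrogroup of a subgyrogroup. -/
def mapSubtype (P : Subgyrogroup G) (H : Subgyrogroup P) : Subgyrogroup G :=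
  ofClosed {x | ∃ h : x ∈ P, (⟨x, h⟩ : P) ∈ H} ⟨P.zero_mem, H.zero_mem⟩
    (fun ⟨hx, hx'⟩ ⟨hy, hy'⟩ => ⟨P.add_mem hx hy, H.add_mem hx' hy'⟩)
    (fun ⟨hx, hx'⟩ => ⟨P.neg_mem hx, H.neg_mem hx'⟩)
    (fun ⟨hx, hx'⟩ ⟨hy, hy'⟩ ⟨hz, hz'⟩ => ⟨P.gyr_symm_mem hx hy hz, H.gyr_symm_mem hx' hy' hz'⟩)

/-- A subgyrogroup of `P` is also one of `G`, so generating in `P` and in `G` amount to the same. -/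
theorem mem_generate_preimage {P : Subgyrogroup G} {L : Set G} (hL : generate L = P) (x : P) :
    x ∈ generate ((↑) ⁻¹' L : Set P) := by
  intro H hH
  have hx : (x : G) ∈ generate L := hL ▸ x.2
  have hLP : L ⊆ P := hL ▸ subset_generate L
  obtain ⟨_, h⟩ := hx (mapSubtype P H) fun y hy => ⟨hLP hy, hH (a := ⟨y, hLP hy⟩) hy⟩
  exact h

end Subgyrogroup

/-! ### Neighborhoods of `0` and finite nets -/

section Topology

variable {G : Type*} [TopologicalSpace G] [Gyrogroup G]

theorem eventually_neg_add_mem [IsTopologicalGyrogroup G] (x : G) {V : Set G}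
    (hV : V ∈ 𝓝 (0 : G)) : ∀ᶠ v in 𝓝 x, -v + x ∈ V := by
  have h : Continuous fun v : G => -v + x := by fun_prop
  exact h.continuousAt.eventually_mem (by rwa [Gyrogroup.neg_add_cancel])

theorem exists_nhds_zero_add_mem [IsTopologicalGyrogroup G] {O : Set G} (hO : O ∈ 𝓝 (0 : G)) :
    ∃ V ∈ 𝓝 (0 : G), ∀ v ∈ V, ∀ w ∈ V, v + w ∈ O := by
  have h : ContinuousAt (fun p : G × G => p.1 + p.2) (0, 0) := continuous_add.continuousAt
  have h' := h.eventually_mem (by simpa only [Gyrogroup.zero_add] using hO)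
  rw [nhds_prod_eq] at h'
  obtain ⟨V, hV, h⟩ := mem_prod_self_iff.1 h'
  exact ⟨V, hV, fun v hv w hw => h (Set.mk_mem_prod hv hw)⟩

/-- A point `y` of the closure has some `v ∈ V` so near that `-v + y ∈ V`, and `y = v + (-v + y)`.
-/
theorem closure_subset_of_add_mem [IsTopologicalGyrogroup G] {V O : Set G}
    (hV : V ∈ 𝓝 (0 : G)) (h : ∀ v ∈ V, ∀ w ∈ V, v + w ∈ O) : closure V ⊆ O := by
  intro y hy
  obtain ⟨v, hv, hvV⟩ := mem_closure_iff_nhds.1 hy _ (eventually_neg_add_mem y hV)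
  have := h v hvV _ hv
  rwa [Gyrogroup.add_neg_add_cancel] at this

/-- If `{0}` is a `Gδ`, then it is the intersection of the closures of a decreasing sequence of
neighborhoods of `0`. -/
theorem exists_antitone_nhds_zero [IsTopologicalGyrogroup G] (h : IsGδ ({0} : Set G)) :
    ∃ V : ℕ → Set G, Antitone V ∧ (∀ n, V n ∈ 𝓝 (0 : G)) ∧
      ∀ x : G, x ≠ 0 → ∃ n, x ∉ closure (V n) := by
  obtain ⟨O, hO, hO0⟩ := isGδ_iff_eq_iInter_nat.1 h
  have hmem : ∀ n, O n ∈ 𝓝 (0 : G) := fun n =>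
    (hO n).mem_nhds (Set.mem_iInter.1 (hO0 ▸ Set.mem_singleton (0 : G)) n)
  choose W hW hWadd using fun n => exists_nhds_zero_add_mem (hmem n)
  refine ⟨fun n => ⋂ i ∈ Set.Iic n, W i, fun m n hmn => ?_, fun n => ?_, fun x hx => ?_⟩
  · exact Set.biInter_subset_biInter_left (Set.Iic_subset_Iic.2 hmn)
  · exact (biInter_mem (Set.finite_Iic n)).2 fun i _ => hW i
  · by_contra! hcon
    refine hx (?_ : x ∈ ({0} : Set G))
    rw [hO0]
    refine Set.mem_iInter.2 fun n => closure_subset_of_add_mem (hW n) (hWadd n) ?_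
    exact closure_mono (Set.biInter_subset_of_mem (Set.mem_Iic.2 le_rfl)) (hcon n)

/-- In a left precompact strongly topological gyrogroup, the finitely many translates that cover
can be taken from any dense set. -/
theorem LeftPrecompact.exists_finite_subset_dense [IsStronglyTopologicalGyrogroup G]
    (hG : LeftPrecompact G) {P : Set G} (hP : Dense P) {V : Set G} (hV : V ∈ 𝓝 (0 : G)) :
    ∃ F : Set G, F.Finite ∧ F ⊆ P ∧ ∀ g : G, ∃ f ∈ F, -f + g ∈ V := by
  obtain ⟨W, hW, hWadd⟩ := exists_nhds_zero_add_mem hV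
  obtain ⟨𝒰, hbasis, hinv⟩ :=
    IsStronglyTopologicalGyrogroup.exists_invariant_basis (G := G)
  obtain ⟨U, hU, hUW⟩ := hbasis.mem_iff.1 hW
  have hU0 : U ∈ 𝓝 (0 : G) := hbasis.mem_of_mem hU
  obtain ⟨F, hF, hFU⟩ := hG (interior U) isOpen_interior ⟨0, mem_interior_iff_mem_nhds.2 hU0⟩
  choose q hqP hq using fun f : G =>
    mem_closure_iff_nhds.1 (hP f) _ (eventually_neg_add_mem f hU0)
  refine ⟨q '' F, hF.image q, ?_, fun g => ?_⟩
  · rintro _ ⟨f, -, rfl⟩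
    exact hq f
  · obtain ⟨f, hf, u, hu, rfl⟩ : g ∈ Set.image2 (fun f u => f + u) F (interior U) :=
      hFU ▸ Set.mem_univ g
    refine ⟨q f, ⟨f, hf, rfl⟩, ?_⟩
    -- `-q f + (f + u) = (-q f + f) + gyr (-q f) f u`; gyration invariance of `U` keeps the last
    -- term in `U`.
    rw [Gyrogroup.gyr_assoc]
    refine hWadd _ (hUW (hqP f)) _ (hUW ?_)
    have := Set.mem_image_of_mem (Gyrogroup.gyr (-q f) f) (interior_subset hu)
    rwa [hinv _ _ U hU] at this

/-- A finite subset of `P` whose span is `V`-dense can be enlarged, by finitely many elements of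
`V`, to one whose span is `V'`-dense and contains a prescribed `p ∈ P`. -/
theorem LeftPrecompact.exists_enlargement [IsStronglyTopologicalGyrogroup G]
    (hG : LeftPrecompact G) {P : Subgyrogroup G} (hP : Dense (P : Set G)) {V V' : Set G}
    (hV' : V' ∈ 𝓝 (0 : G)) {p : G} (hp : p ∈ P) {A : Set G} (hA : A.Finite) (hAP : A ⊆ P)
    (hAV : ∀ g : G, ∃ h ∈ Subgyrogroup.generate A, -h + g ∈ V) :
    ∃ B : Set G, (B.Finite ∧ B ⊆ P ∧ ∀ g : G, ∃ h ∈ Subgyrogroup.generate B, -h + g ∈ V') ∧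
      A ⊆ B ∧ B \ A ⊆ V ∧ p ∈ Subgyrogroup.generate B := by
  obtain ⟨F, hF, hFP, hFV⟩ := hG.exists_finite_subset_dense hP hV'
  choose h hh hhV using hAV
  -- Only the corrections `-h f + f`, which lie in `V`, are adjoined, not the elements `f`
  -- themselves.
  let B : Set G := A ∪ (fun f => -h f + f) '' insert p F
  have hspan : ∀ f ∈ insert p F, f ∈ Subgyrogroup.generate B := by
    intro f hf
    rw [← Gyrogroup.add_neg_add_cancel (h f) f]
    refine Subgyrogroup.add_mem _ (Subgyrogroup.generate_le ?_ (hh f))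
      (Subgyrogroup.subset_generate B (Or.inr ⟨f, hf, rfl⟩))
    exact Set.subset_union_left.trans (Subgyrogroup.subset_generate B)
  refine ⟨B, ⟨hA.union ((hF.insert p).image _), Set.union_subset hAP ?_, fun g => ?_⟩,
    Set.subset_union_left, ?_, hspan p (Set.mem_insert p F)⟩
  · rintro _ ⟨f, hf, rfl⟩
    exact P.add_mem (P.neg_mem (Subgyrogroup.generate_le hAP (hh f)))
      (Set.insert_subset hp hFP hf)
  · obtain ⟨f, hf, hfg⟩ := hFV g
    exact ⟨f, hspan f (Set.mem_insert_of_mem p hf), hfg⟩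
  · rintro _ ⟨hx | ⟨f, -, rfl⟩, hxA⟩
    · exact absurd hx hxA
    · exact hhV f

/-- For a decreasing sequence `V` of neighborhoods of `0`, a countable dense subgyrogroup is
generated by a set of nonzero elements of which only finitely many lie outside any `V n`. -/
theorem LeftPrecompact.exists_generating_set [IsStronglyTopologicalGyrogroup G]
    (hG : LeftPrecompact G) {P : Subgyrogroup G} (hPc : (P : Set G).Countable)
    (hP : Dense (P : Set G)) {V : ℕ → Set G} (hanti : Antitone V)
    (hV : ∀ n, V n ∈ 𝓝 (0 : G)) :
    ∃ L : Set G, L ⊆ P ∧ 0 ∉ L ∧ Subgyrogroup.generate L = P ∧ ∀ n, (L \ V n).Finite := by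
  obtain ⟨p, hp⟩ := hPc.exists_eq_range ⟨0, P.zero_mem⟩
  have hpP : ∀ n, p n ∈ P := fun n => by
    have : p n ∈ (P : Set G) := hp ▸ Set.mem_range_self n
    exact this
  let Good (n : ℕ) (A : Set G) : Prop :=
    A.Finite ∧ A ⊆ P ∧ ∀ g : G, ∃ h ∈ Subgyrogroup.generate A, -h + g ∈ V n
  have start : ∃ A, Good 0 A := by
    obtain ⟨F, hF, hFP, hFV⟩ := hG.exists_finite_subset_dense hP (hV 0)
    refine ⟨F, hF, hFP, fun g => ?_⟩
    obtain ⟨f, hf, hfg⟩ := hFV g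
    exact ⟨f, Subgyrogroup.subset_generate F hf, hfg⟩
  have step : ∀ n (A : {A // Good n A}), ∃ B : {B // Good (n + 1) B},
      A.1 ⊆ B.1 ∧ B.1 \ A.1 ⊆ V n ∧ p n ∈ Subgyrogroup.generate B.1 := by
    rintro n ⟨A, hA, hAP, hAV⟩
    obtain ⟨B, hB, h⟩ := hG.exists_enlargement hP (hV (n + 1)) (hpP n) hA hAP hAV
    exact ⟨⟨B, hB⟩, h⟩
  choose next hsub hdiff hgen using step
  let A : ∀ n, {A // Good n A} := fun n =>
    Nat.rec ⟨start.choose, start.choose_spec⟩ (fun n A => next n A) n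
  have hsub' : ∀ n, (A n).1 ⊆ (A (n + 1)).1 := fun n => hsub n (A n)
  have hdiff' : ∀ n, (A (n + 1)).1 \ (A n).1 ⊆ V n := fun n => hdiff n (A n)
  have hgen' : ∀ n, p n ∈ Subgyrogroup.generate (A (n + 1)).1 := fun n => hgen n (A n)
  have htail : ∀ n m, (A m).1 ⊆ (A n).1 ∪ V n := by
    intro n m
    rcases le_total m n with hmn | hnm
    · exact (monotone_nat_of_le_succ hsub' hmn).trans Set.subset_union_left
    · induction m, hnm using Nat.le_induction with
      | base => exact Set.subset_union_left
      | succ m hnm ih =>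
        intro x hx
        by_cases hxm : x ∈ (A m).1
        · exact ih hxm
        · exact Or.inr (hanti hnm (hdiff' m ⟨hx, hxm⟩))
  have hLP : (⋃ n, (A n).1) \ {0} ⊆ (P : Set G) := fun x hx => by
    obtain ⟨n, hn⟩ := Set.mem_iUnion.1 hx.1
    exact (A n).2.2.1 hn
  refine ⟨(⋃ n, (A n).1) \ {0}, hLP, fun h => h.2 rfl, ?_, fun n => ?_⟩
  · refine SetLike.ext fun x => ⟨Subgyrogroup.generate_le hLP, fun hx => ?_⟩
    obtain ⟨n, rfl⟩ : x ∈ Set.range p := hp ▸ hx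
    refine Subgyrogroup.generate_le (fun y hy => ?_) (hgen' n)
    -- Removing `0` does not shrink the span.
    by_cases hy0 : y = 0
    · rw [hy0]
      exact Subgyrogroup.zero_mem _
    · exact Subgyrogroup.subset_generate _ ⟨Set.mem_iUnion.2 ⟨n + 1, hy⟩, hy0⟩
  -- After stage `n` every new element lies in `V n`, so `L \ V n ⊆ A n`.
  · refine (A n).2.1.subset fun x hx => ?_
    obtain ⟨m, hm⟩ := Set.mem_iUnion.1 hx.1.1
    exact (htail n m hm).resolve_right hx.2

end Topology

/-! ### Sets with at most one accumulation point -/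

section DiscreteSets

variable {X : Type*} [TopologicalSpace X]

theorem discreteTopology_of_eventually_eq {S : Set X}
    (h : ∀ x ∈ S, ∀ᶠ y in 𝓝 x, y ∈ S → y = x) : DiscreteTopology S := by
  refine discreteTopology_iff_nhds.2 fun x => le_antisymm ?_ (pure_le_nhds x)
  refine le_pure_iff.2 ?_
  filter_upwards [continuous_subtype_val.continuousAt.eventually (h x x.2)] with y hy
  exact Subtype.ext (hy y.2)

theorem isClosed_union_singleton_of_eventually_eq [T1Space X] {S : Set X} {z : X}
    (h : ∀ x, x ≠ z → ∀ᶠ y in 𝓝 x, y ∈ S → y = x) : IsClosed (S ∪ {z}) := by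
  refine isOpen_compl_iff.1 (isOpen_iff_mem_nhds.2 fun x hx => ?_)
  have hxz : x ≠ z := fun e => hx (Or.inr e)
  filter_upwards [h x hxz, isOpen_ne.mem_nhds hxz] with y hy hyz
  rintro (hyS | hyz')
  · exact hx (Or.inl (hy hyS ▸ hyS))
  · exact hyz hyz'

end DiscreteSets

theorem mainTheorem6 {G : Type*} [TopologicalSpace G] [Gyrogroup G]
    [IsStronglyTopologicalGyrogroup G] [T2Space G] [TopologicalSpace.SeparableSpace G]
    (hprecompact : LeftPrecompact G) (hpseudo : HasCountablePseudocharacter G)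
    (P : Subgyrogroup G) (hPcountable : (P : Set G).Countable) (hPdense : Dense (P : Set G)) :
    ∃ L : Set G,
      L ⊆ (P : Set G) ∧
      DiscreteTopology L ∧
      -- `L` is a closed subset of the subspace `G ∖ {0}`
      (L ⊆ {0}ᶜ ∧ IsClosed ((↑) ⁻¹' L : Set ({0}ᶜ : Set G))) ∧
      Subgyrogroup.generate L = P ∧
      IsSuitableSet ((↑) ⁻¹' L : Set P) ∧
      IsSuitableSet L := by
  obtain ⟨V, hanti, hV, hV0⟩ := exists_antitone_nhds_zero (hpseudo 0)
  obtain ⟨L, hLP, h0, hgen, hfin⟩ :=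
    hprecompact.exists_generating_set hPcountable hPdense hanti hV
  have hL : ∀ x : G, x ≠ 0 → ∀ᶠ y in 𝓝 x, y ∈ L → y = x := by
    intro x hx
    obtain ⟨n, hn⟩ := hV0 x hx
    -- A finite set is closed, and with `x` itself removed its complement is a neighborhood of `x`.
    have hfar : ∀ᶠ y in 𝓝 x, y ∉ (L \ V n) \ {x} :=
      ((hfin n).subset Set.sdiff_subset).isClosed.isOpen_compl.mem_nhds fun h => h.2 rfl
    filter_upwards [isClosed_closure.isOpen_compl.mem_nhds hn, hfar] with y hy hy' hyL
    by_contra hne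
    exact hy' ⟨⟨hyL, fun h => hy (subset_closure h)⟩, hne⟩
  have hne : ∀ x ∈ L, x ≠ 0 := fun x hx e => h0 (e ▸ hx)
  have hdisc : DiscreteTopology L :=
    discreteTopology_of_eventually_eq fun x hx => hL x (hne x hx)
  have hclosed : IsClosed (L ∪ {0}) := isClosed_union_singleton_of_eventually_eq hL
  have hLP' : ∀ x : P, x ≠ 0 → ∀ᶠ y in 𝓝 x, y ∈ ((↑) ⁻¹' L : Set P) → y = x := by
    intro x hx
    have hx' : (x : G) ≠ 0 := fun e => hx (Subtype.ext e)
    filter_upwards [continuous_subtype_val.continuousAt.eventually (hL x hx')] with y hy hyL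
    exact Subtype.ext (hy hyL)
  refine ⟨L, hLP, hdisc, ⟨hne, ?_⟩, hgen, ⟨?_, ?_, ?_⟩, hdisc, hgen ▸ hPdense, hclosed⟩
  · convert hclosed.preimage (continuous_subtype_val (p := (· ∈ ({0}ᶜ : Set G)))) using 1
    ext x
    exact ⟨Or.inl, fun h => h.resolve_right x.2⟩
  · exact discreteTopology_of_eventually_eq fun x hx =>
      hLP' x fun e => hne _ hx (congrArg Subtype.val e)
  -- The span within `P` is all of `P`.
  · exact dense_univ.mono fun x _ => Subgyrogroup.mem_generate_preimage hgen x
  · exact isClosed_union_singleton_of_eventually_eq hLP'
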